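/- Let $T_1,\dots,T_m:\mathbb R^N\to\mathbb R^N$ be non-singular linear maps with $\|T_i\|<1$. Write $I$ for the set of finite words over $\{1,\dots,m\}$ and $I_\infty$ for the space of infinite words, with the product topology. For $\mathbf i=(i_1,\dots,i_k)\in I$ put $T_{\mathbf i}=T_{i_1}\cdots T_{i_k}$ and let $C_{\mathbf i}\subseteq I_\infty$ be the cylinder of infinite words beginning with $\mathbf i$. Let $\alpha_1(T)\ge\dots\ge\alpha_N(T)$ be the singular values of $T$. For $s>0$ let $$\phi^s(T)=\alpha_1\cdots\alpha_{j-1}\alpha_j^{\,s-j+1}\quad (s\le N,\ j\in\mathbb Z,\ j-1<s\le j),\qquad \phi^s(T)=(\alpha_1\cdots\alpha_N)^{s/N}\quad (s>N),$$ and for $r>0$ let $$J^s(r)=\{(i_1,\dots,i_k)\in I:\ \alpha_j(T_{i_1,\dots,i_k})\le r<\alpha_j(T_{i_1,\dots,i_{k-1}})\},$$ where $j-1<s\le j$ if $s\le N$ and $j=N$ if $s>N$. For a finite Borel measure $\mu$ on $I_\infty$ and $q>1$ define, in $[0,\infty]$ and with $\sup\emptyset=0$, $$d_q^-=\sup\Big\{s>0:\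 \limsup_{r\to0}\sum_{\mathbf i\in J^s(r)}\phi^s(T_{\mathbf i})^{1-q}\mu(C_{\mathbf i})^q<\infty\Big\},\qquad d_q^+=\sup\Big\{s>0:\ \liminf_{r\to0}\sum_{\mathbf i\in J^s(r)}\phi^s(T_{\mathbf i})^{1-q}\mu(C_{\mathbf i})^q<\infty\Big\}.$$ Given a bounded family $\omega=(\omega_{\mathbf i})_{\mathbf i\in I}$ in $\mathbb R^N$, let $\mu^\omega$ be the image of $\mu$ under the map $\Pi^\omega:I_\infty\to\mathbb R^N$, $$\Pi^\omega(\mathbf i)=\omega_{i_1}+T_{i_1}\omega_{i_1,i_2}+T_{i_1}T_{i_2}\omega_{i_1,i_2,i_3}+\cdots.$$ For a finite Borel measure $\tau$ on $\mathbb R^N$ let $M_r(q)=\sum_C\tau(C)^q$, the sum being over all cubes $C=\prod_{l=1}^N[z_lr,(z_l+1)r)$ with $z\in\mathbb Z^N$, and let $$\underline D_q(\tau)=\liminf_{r\to0}\frac{\log M_r(q)}{(q-1)\log r},\qquad \overline D_q(\tau)=\limsup_{r\to0}\frac{\log M_r(q)}{(q-1)\log r}.$$ Then for every non-zero finite Borel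 measure $\mu$ on $I_\infty$, every $q>1$ and every bounded family $\omega$, $$\underline D_q(\mu^\omega)\le\min\{d_q^-,N\}\qquad\text{and}\qquad \overline D_q(\mu^\omega)\le\min\{d_q^+,N\}.$$ -/

import Mathlib

open MeasureTheory Filter Topology
open scoped ENNReal

namespace AlmostSelfAffine

noncomputable section

/-- The index `j` with `j - 1 < s ≤ j` when `0 < s ≤ N`. For `s > N` the last index `N` is used,
and for `s = 0` the index `1` (so that `φ^0 = 1`). -/
def svIndex (N : ℕ) (s : ℝ) : ℕ := max 1 (min ⌈s⌉₊ N)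

/-- The `j`-th singular value `α_j` (`j = 1, …, N`), in decreasing order. Mathlib's
`LinearMap.singularValues` counts from `0`. -/
def sv {N : ℕ} (T : EuclideanSpace ℝ (Fin N) →L[ℝ] EuclideanSpace ℝ (Fin N)) (j : ℕ) : ℝ :=
  T.toLinearMap.singularValues (j - 1)

/-- The singular value function `φ^s(T)`, for `s ≥ 0`: it is `α_1 ⋯ α_{j-1} α_j^{s-j+1}` with
`j - 1 < s ≤ j` if `s ≤ N`, and `(α_1 ⋯ α_N)^{s/N}` if `s > N`. -/
def svFun {N : ℕ} (T : EuclideanSpace ℝ (Fin N) →L[ℝ] EuclideanSpace ℝ (Fin N)) (s : ℝ) : ℝ :=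
  if s ≤ N then
    (∏ l ∈ Finset.Ico 1 (svIndex N s), sv T l) *
      sv T (svIndex N s) ^ (s - (svIndex N s : ℝ) + 1)
  else
    (∏ l ∈ Finset.Icc 1 N, sv T l) ^ (s / (N : ℝ))

/-- The composition `T_{i_1} T_{i_2} ⋯ T_{i_k}` along a finite word. -/
def wordMap {N m : ℕ} (T : Fin m → EuclideanSpace ℝ (Fin N) →L[ℝ] EuclideanSpace ℝ (Fin N))
    (w : List (Fin m)) : EuclideanSpace ℝ (Fin N) →L[ℝ] EuclideanSpace ℝ (Fin N) :=
  (w.map T).prod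

/-- The curtailment `i|_k` of an infinite word. -/
def curtail {m : ℕ} (i : ℕ → Fin m) (k : ℕ) : List (Fin m) :=
  List.ofFn fun l : Fin k => i l

/-- The cylinder of all infinite words that begin with `w`. -/
def cylinder {m : ℕ} (w : List (Fin m)) : Set (ℕ → Fin m) :=
  {i | curtail i w.length = w}

/-- The projection
`Π^ω(i) = ω_{i_1} + T_{i_1} ω_{i_1 i_2} + T_{i_1} T_{i_2} ω_{i_1 i_2 i_3} + ⋯`. -/
def projection {N m : ℕ} (T : Fin m → EuclideanSpace ℝ (Fin N) →L[ℝ] EuclideanSpace ℝ (Fin N))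
    (ω : List (Fin m) → EuclideanSpace ℝ (Fin N)) (i : ℕ → Fin m) : EuclideanSpace ℝ (Fin N) :=
  ∑' k : ℕ, wordMap T (curtail i k) (ω (curtail i (k + 1)))

/-- The image `μ^ω` of the measure `μ` on code space under the projection. -/
def projMeasure {N m : ℕ} (T : Fin m → EuclideanSpace ℝ (Fin N) →L[ℝ] EuclideanSpace ℝ (Fin N))
    (ω : List (Fin m) → EuclideanSpace ℝ (Fin N)) (μ : Measure (ℕ → Fin m)) :
    Measure (EuclideanSpace ℝ (Fin N)) :=
  μ.map (projection T ω)

/-- The `r`-mesh cube with integer position `z`. -/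
def meshCube {N : ℕ} (r : ℝ) (z : Fin N → ℤ) : Set (EuclideanSpace ℝ (Fin N)) :=
  {x | ∀ l, (z l : ℝ) * r ≤ x l ∧ x l < ((z l : ℝ) + 1) * r}

/-- The moment sum `M_r(q)` over all `r`-mesh cubes; for `q > 0` null cubes contribute `0`. -/
def momentSum {N : ℕ} (τ : Measure (EuclideanSpace ℝ (Fin N))) (q r : ℝ) : ℝ≥0∞ :=
  ∑' z : Fin N → ℤ, τ (meshCube r z) ^ q

/-- The lower generalised `q`-dimension. -/
def lowerDim {N : ℕ} (q : ℝ) (τ : Measure (EuclideanSpace ℝ (Fin N))) : EReal :=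
  liminf (fun r : ℝ => ENNReal.log (momentSum τ q r) / (((q - 1) * Real.log r : ℝ) : EReal))
    (𝓝[>] 0)

/-- The upper generalised `q`-dimension. -/
def upperDim {N : ℕ} (q : ℝ) (τ : Measure (EuclideanSpace ℝ (Fin N))) : EReal :=
  limsup (fun r : ℝ => ENNReal.log (momentSum τ q r) / (((q - 1) * Real.log r : ℝ) : EReal))
    (𝓝[>] 0)

/-- The cut-set `J^s(r)`: the words `w = i_1 … i_k` with
`α_j(T_{i_1 … i_k}) ≤ r < α_j(T_{i_1 … i_{k-1}})`. The empty word never satisfies this, since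
dropping the last letter leaves it unchanged. -/
def cutSet {N m : ℕ} (T : Fin m → EuclideanSpace ℝ (Fin N) →L[ℝ] EuclideanSpace ℝ (Fin N))
    (s r : ℝ) : Set (List (Fin m)) :=
  {w | sv (wordMap T w) (svIndex N s) ≤ r ∧ r < sv (wordMap T w.dropLast) (svIndex N s)}

/-- The sum of `φ^s(T_w)^{1-q} μ(C_w)^q` over `w ∈ J^s(r)`. -/
def cutSum {N m : ℕ} (T : Fin m → EuclideanSpace ℝ (Fin N) →L[ℝ] EuclideanSpace ℝ (Fin N))
    (μ : Measure (ℕ → Fin m)) (q s r : ℝ) : ℝ≥0∞ :=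
  ∑' w : cutSet T s r,
    ENNReal.ofReal (svFun (wordMap T (w : List (Fin m))) s ^ (1 - q)) *
      μ (cylinder (w : List (Fin m))) ^ q

/-- `d_q^-`: the supremum in `[0, ∞]` (hence `0` for the empty set) of all `s > 0` such that the
cut-set sums have finite upper limit as `r → 0`. -/
def dMinus {N m : ℕ} (T : Fin m → EuclideanSpace ℝ (Fin N) →L[ℝ] EuclideanSpace ℝ (Fin N))
    (μ : Measure (ℕ → Fin m)) (q : ℝ) : ℝ≥0∞ :=
  ⨆ (s : ℝ) (_ : 0 < s ∧ limsup (fun r : ℝ => cutSum T μ q s r) (𝓝[>] 0) < ∞), ENNReal.ofReal s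

/-- `d_q^+`: the supremum in `[0, ∞]` (hence `0` for the empty set) of all `s > 0` such that the
cut-set sums have finite lower limit as `r → 0`. -/
def dPlus {N m : ℕ} (T : Fin m → EuclideanSpace ℝ (Fin N) →L[ℝ] EuclideanSpace ℝ (Fin N))
    (μ : Measure (ℕ → Fin m)) (q : ℝ) : ℝ≥0∞ :=
  ⨆ (s : ℝ) (_ : 0 < s ∧ liminf (fun r : ℝ => cutSum T μ q s r) (𝓝[>] 0) < ∞), ENNReal.ofReal s

end

end AlmostSelfAffine

/-! Let 0 < s ≤ N and w ∈ J^s(r). The projection sends C_w into a translate of T_w(B(0,R)), with R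
depending only on the contraction ratio and the bound on ω, and hence into a box with half-sides
α_l(T_w)R. Since α_j(T_w) is comparable to r, at most a constant times φ^s(T_w) r^{-s} mesh cubes
meet this box (`prod_le_mul_svFun`). Hölder's inequality over those cubes bounds μ(C_w)^q by a
constant times (φ^s(T_w) r^{-s})^{q-1} times the moment sum of the image of μ restricted to C_w. The
cylinders are disjoint and x ↦ x^q is superadditive, so summing over w gives `exists_cutSum_le`: the
cut-set sum is at most C r^{-s(q-1)} M_r(q).

If s is less than log M_r(q) / ((q-1) log r), then M_r(q) ≤ r^{s(q-1)} and the cut-set sum is at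
most C. For s below the lower dimension this happens for all small r, for s below the upper
dimension for arbitrarily small r; this matches the limsup in d_q^- and the liminf in d_q^+. The
same count for the empty word bounds both dimensions by N, so only s ≤ N has to be tested. -/

namespace AlmostSelfAffine

open scoped RealInnerProductSpace

/-! ### Singular values: behaviour under composition, and principal axes. -/

section SingularValues

variable {N : ℕ}

/-- An orthonormal basis of right singular vectors. -/
theorem exists_orthonormalBasis_inner_map_map
    (T : EuclideanSpace ℝ (Fin N) →ₗ[ℝ] EuclideanSpace ℝ (Fin N)) :
    ∃ v : OrthonormalBasis (Fin N) ℝ (EuclideanSpace ℝ (Fin N)),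
      ∀ l y, ⟪T (v l), T y⟫ = T.singularValues l ^ 2 * ⟪v l, y⟫ := by
  have hn : Module.finrank ℝ (EuclideanSpace ℝ (Fin N)) = N := by simp
  refine ⟨T.isSymmetric_adjoint_comp_self.eigenvectorBasis hn, fun l y => ?_⟩
  have h := T.isSymmetric_adjoint_comp_self.apply_eigenvectorBasis hn l
  rw [T.sq_singularValues_fin hn, ← LinearMap.adjoint_inner_left]
  rw [LinearMap.comp_apply] at h
  rw [h, inner_smul_left]
  simp

theorem norm_map_sq_eq_sum
    (T : EuclideanSpace ℝ (Fin N) →ₗ[ℝ] EuclideanSpace ℝ (Fin N))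
    (v : OrthonormalBasis (Fin N) ℝ (EuclideanSpace ℝ (Fin N)))
    (hv : ∀ l y, ⟪T (v l), T y⟫ = T.singularValues l ^ 2 * ⟪v l, y⟫)
    (x : EuclideanSpace ℝ (Fin N)) :
    ‖T x‖ ^ 2 = ∑ l : Fin N, T.singularValues l ^ 2 * ⟪v l, x⟫ ^ 2 := by
  rw [← real_inner_self_eq_norm_sq]
  nth_rewrite 1 [← v.sum_repr' x]
  rw [map_sum, sum_inner]
  refine Finset.sum_congr rfl fun l _ => ?_
  rw [map_smul, inner_smul_left, hv]
  simp only [conj_trivial]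
  ring

theorem norm_sq_eq_sum_inner_sq
    (v : OrthonormalBasis (Fin N) ℝ (EuclideanSpace ℝ (Fin N)))
    (x : EuclideanSpace ℝ (Fin N)) :
    ‖x‖ ^ 2 = ∑ l : Fin N, ⟪v l, x⟫ ^ 2 := by
  rw [← v.sum_sq_norm_inner_right x]
  simp

/-- A nonzero vector satisfying `N - 1` prescribed linear conditions. -/
theorem exists_ne_zero_forall_ne_eq_zero (k : Fin N)
    (f : Fin N → EuclideanSpace ℝ (Fin N) →ₗ[ℝ] ℝ) :
    ∃ x ≠ 0, ∀ l ≠ k, f l x = 0 := by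
  let L : EuclideanSpace ℝ (Fin N) →ₗ[ℝ] (Fin N → ℝ) :=
    LinearMap.pi fun l => if l = k then 0 else f l
  have hfr : Module.finrank ℝ (EuclideanSpace ℝ (Fin N)) = Module.finrank ℝ (Fin N → ℝ) := by
    simp
  -- The k-th coordinate of `L` vanishes identically, so `L` is not surjective; equal dimensions
  -- then make it non-injective.
  have hns : ¬ Function.Surjective L := fun h => by
    obtain ⟨x, hx⟩ := h (fun _ => 1)
    simpa [L] using congrFun hx k
  rw [← LinearMap.injective_iff_surjective_of_finrank_eq_finrank hfr,
    injective_iff_map_eq_zero] at hns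
  push Not at hns
  obtain ⟨x, hx, hx0⟩ := hns
  refine ⟨x, hx0, fun l hl => ?_⟩
  simpa [L, hl] using congrFun hx l

/-- A min-max argument. Take x ≠ 0 in the span of the right singular vectors 0, …, k of AB, with Bx
orthogonal to the right singular vectors 0, …, k-1 of A. Then ABx has norm at least σ_k(AB)‖x‖ and
at most σ_k(A)‖Bx‖. -/
theorem singularValues_comp_le
    (A B : EuclideanSpace ℝ (Fin N) →L[ℝ] EuclideanSpace ℝ (Fin N)) (k : ℕ) :
    (A * B).toLinearMap.singularValues k ≤ A.toLinearMap.singularValues k * ‖B‖ := by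
  rcases le_or_gt N k with hk | hk
  · rw [LinearMap.singularValues_of_finrank_le _ (by simpa using hk),
      LinearMap.singularValues_of_finrank_le _ (by simpa using hk)]
    simp
  obtain ⟨u, hu⟩ := exists_orthonormalBasis_inner_map_map (A * B).toLinearMap
  obtain ⟨v, hv⟩ := exists_orthonormalBasis_inner_map_map A.toLinearMap
  -- There are k conditions on Bx and N-1-k conditions on x; only the index k imposes none.
  obtain ⟨x, hx0, hx⟩ := exists_ne_zero_forall_ne_eq_zero ⟨k, hk⟩
    (fun l => if (l : ℕ) < k then (innerₗ _ (v l)) ∘ₗ B.toLinearMap else innerₗ _ (u l))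
  have hxv : ∀ l : Fin N, (l : ℕ) < k → ⟪v l, B x⟫ = 0 := fun l hl => by
    simpa [hl] using hx l (by rintro rfl; simp at hl)
  have hxu : ∀ l : Fin N, k < (l : ℕ) → ⟪u l, x⟫ = 0 := fun l hl => by
    simpa [hl.le.not_gt] using hx l (by rintro rfl; simp at hl)
  set σ := (A * B).toLinearMap.singularValues k
  set τ := A.toLinearMap.singularValues k
  have hσ : 0 ≤ σ := LinearMap.singularValues_nonneg _ _
  have hτ : 0 ≤ τ := LinearMap.singularValues_nonneg _ _
  have h1 : σ ^ 2 * ‖x‖ ^ 2 ≤ ‖(A * B).toLinearMap x‖ ^ 2 := by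
    rw [norm_map_sq_eq_sum _ u hu, norm_sq_eq_sum_inner_sq u, Finset.mul_sum]
    refine Finset.sum_le_sum fun l _ => ?_
    rcases le_or_gt (l : ℕ) k with hl | hl
    · gcongr
      exact LinearMap.singularValues_antitone _ hl
    · simp [hxu l hl]
  have h2 : ‖A.toLinearMap (B x)‖ ^ 2 ≤ τ ^ 2 * ‖B x‖ ^ 2 := by
    rw [norm_map_sq_eq_sum _ v hv, norm_sq_eq_sum_inner_sq v, Finset.mul_sum]
    refine Finset.sum_le_sum fun l _ => ?_
    rcases le_or_gt k (l : ℕ) with hl | hl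
    · gcongr
      · exact LinearMap.singularValues_nonneg _ _
      · exact LinearMap.singularValues_antitone _ hl
    · simp [hxv l hl]
  have h3 : (A * B).toLinearMap x = A.toLinearMap (B x) := rfl
  rw [h3] at h1
  have h4 : (σ * ‖x‖) ^ 2 ≤ (τ * ‖B‖ * ‖x‖) ^ 2 := by
    calc (σ * ‖x‖) ^ 2 = σ ^ 2 * ‖x‖ ^ 2 := by ring
      _ ≤ τ ^ 2 * ‖B x‖ ^ 2 := h1.trans h2
      _ ≤ τ ^ 2 * (‖B‖ * ‖x‖) ^ 2 := by gcongr; exact B.le_opNorm x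
      _ = _ := by ring
  have h5 := le_of_sq_le_sq h4 (by positivity)
  exact le_of_mul_le_mul_right h5 (norm_pos_iff.mpr hx0)

/-- An orthonormal basis of left singular vectors: the principal axes of the image of a ball. -/
theorem exists_orthonormalBasis_abs_inner_map_le
    (T : EuclideanSpace ℝ (Fin N) →ₗ[ℝ] EuclideanSpace ℝ (Fin N)) (hT : Function.Injective T) :
    ∃ u : OrthonormalBasis (Fin N) ℝ (EuclideanSpace ℝ (Fin N)),
      ∀ l x, |⟪u l, T x⟫| ≤ T.singularValues l * ‖x‖ := by
  obtain ⟨v, hv⟩ := exists_orthonormalBasis_inner_map_map T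
  have hpos : ∀ l : Fin N, 0 < T.singularValues l := fun l =>
    T.injective_iff_forall_lt_finrank_singularValues_pos.mp hT l (by simp)
  let u : Fin N → EuclideanSpace ℝ (Fin N) := fun l => (T.singularValues l)⁻¹ • T (v l)
  have hinner : ∀ l x, ⟪u l, T x⟫ = T.singularValues l * ⟪v l, x⟫ := fun l x => by
    have := (hpos l).ne'
    simp only [u, inner_smul_left, hv, conj_trivial]
    field_simp
  have hu : Orthonormal ℝ u := by
    rw [orthonormal_iff_ite]
    intro i l
    have := (hpos i).ne'
    have h : ⟪u i, u l⟫ = (T.singularValues l)⁻¹ * ⟪u i, T (v l)⟫ := by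
      simp only [u, inner_smul_right]
    rw [h, hinner, orthonormal_iff_ite.mp v.orthonormal]
    split_ifs with h
    · subst h; field_simp
    · simp
  have hc : Fintype.card (Fin N) = Module.finrank ℝ (EuclideanSpace ℝ (Fin N)) := by simp
  refine ⟨OrthonormalBasis.mk hu
    (hu.linearIndependent.span_eq_top_of_card_eq_finrank' hc).ge, fun l x => ?_⟩
  rw [OrthonormalBasis.coe_mk, hinner, abs_mul, abs_of_pos (hpos l)]
  gcongr
  exact (hpos l).le
  simpa using abs_real_inner_le_norm (v l) x

end SingularValues

/-! ### Mesh cubes: counting by volume and Hölder's inequality. -/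

section MeshCubes

variable {N : ℕ}

theorem volume_setOf_abs_inner_sub_le
    (u : OrthonormalBasis (Fin N) ℝ (EuclideanSpace ℝ (Fin N)))
    (y : EuclideanSpace ℝ (Fin N)) (a : Fin N → ℝ) :
    volume {x | ∀ l, |⟪u l, x - y⟫| ≤ a l} = ∏ l, ENNReal.ofReal (2 * a l) := by
  have hmp := (PiLp.volume_preserving_ofLp (Fin N)).comp u.measurePreserving_repr
  have hset : {x | ∀ l, |⟪u l, x - y⟫| ≤ a l} =
      (WithLp.ofLp ∘ u.repr) ⁻¹'
        Set.Icc (fun l => ⟪u l, y⟫ - a l) (fun l => ⟪u l, y⟫ + a l) := by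
    ext x
    simp only [Set.mem_ofPred_eq, Set.mem_preimage, Set.mem_Icc, Pi.le_def, Function.comp_apply,
      u.repr_apply_apply, inner_sub_right, abs_le, ← forall_and]
    refine forall_congr' fun l => ?_
    constructor <;> rintro ⟨h, h'⟩ <;> constructor <;> linarith
  rw [hset, hmp.measure_preimage measurableSet_Icc.nullMeasurableSet, Real.volume_Icc_pi]
  refine Finset.prod_congr rfl fun l _ => ?_
  congr 1
  ring

theorem meshCube_eq_preimage (r : ℝ) (z : Fin N → ℤ) :
    meshCube r z = WithLp.ofLp ⁻¹'
      Set.pi Set.univ fun l => Set.Ico ((z l : ℝ) * r) (((z l : ℝ) + 1) * r) := by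
  ext x
  simp [meshCube]

theorem measurableSet_meshCube (r : ℝ) (z : Fin N → ℤ) : MeasurableSet (meshCube r z) := by
  rw [meshCube_eq_preimage]
  exact (PiLp.volume_preserving_ofLp (Fin N)).measurable
    (MeasurableSet.univ_pi fun _ => measurableSet_Ico)

theorem volume_meshCube (r : ℝ) (z : Fin N → ℤ) :
    volume (meshCube r z) = ENNReal.ofReal r ^ N := by
  rw [meshCube_eq_preimage, (PiLp.volume_preserving_ofLp (Fin N)).measure_preimage
    (MeasurableSet.univ_pi fun _ => measurableSet_Ico).nullMeasurableSet, Real.volume_pi_Ico]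
  have : ∀ l, ((z l : ℝ) + 1) * r - z l * r = r := fun l => by ring
  simp [this]

theorem mem_meshCube_iff {r : ℝ} (hr : 0 < r) (z : Fin N → ℤ) (x : EuclideanSpace ℝ (Fin N)) :
    x ∈ meshCube r z ↔ z = fun l => ⌊x l / r⌋ := by
  rw [eq_comm, funext_iff]
  refine forall_congr' fun l => ?_
  rw [Int.floor_eq_iff, le_div_iff₀ hr, div_lt_iff₀ hr]

theorem pairwise_disjoint_meshCube {r : ℝ} (hr : 0 < r) :
    Pairwise (Function.onFun Disjoint (meshCube (N := N) r)) := by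
  intro z z' hz
  refine Set.disjoint_left.mpr fun x hx hx' => hz ?_
  rw [mem_meshCube_iff hr] at hx hx'
  rw [hx, hx']

theorem iUnion_meshCube {r : ℝ} (hr : 0 < r) :
    ⋃ z, meshCube (N := N) r z = Set.univ :=
  Set.eq_univ_of_forall fun x => Set.mem_iUnion.mpr ⟨_, (mem_meshCube_iff hr _ x).mpr rfl⟩

theorem norm_sub_le_of_mem_meshCube {r : ℝ} (hr : 0 < r) {z : Fin N → ℤ}
    {x y : EuclideanSpace ℝ (Fin N)} (hx : x ∈ meshCube r z) (hy : y ∈ meshCube r z) :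
    ‖x - y‖ ≤ √N * r := by
  rw [EuclideanSpace.norm_eq, ← Real.sqrt_sq hr.le, ← Real.sqrt_mul (by positivity)]
  refine Real.sqrt_le_sqrt ?_
  calc ∑ l, ‖(x - y) l‖ ^ 2 ≤ ∑ _l : Fin N, r ^ 2 := by
        refine Finset.sum_le_sum fun l _ => ?_
        have h1 := hx l
        have h2 := hy l
        gcongr
        rw [PiLp.sub_apply, Real.norm_eq_abs, abs_le]
        constructor <;> nlinarith
    _ = N * r ^ 2 := by simp

/-- The number of `r`-mesh cubes meeting a rectangular box, bounded by comparing volumes. -/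
theorem card_le_of_meshCube_meets_box {r : ℝ} (hr : 0 < r)
    (u : OrthonormalBasis (Fin N) ℝ (EuclideanSpace ℝ (Fin N)))
    (y : EuclideanSpace ℝ (Fin N)) {a : Fin N → ℝ} (ha : ∀ l, 0 ≤ a l)
    (F : Finset (Fin N → ℤ))
    (hF : ∀ z ∈ F, ∃ x ∈ meshCube r z, ∀ l, |⟪u l, x - y⟫| ≤ a l) :
    (F.card : ℝ) ≤ ∏ l, 2 * (a l / r + √N) := by
  -- A cube has diameter at most √N r, so enlarging the half-sides by this much swallows every cube
  -- that meets the box.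
  have hsub : ⋃ z ∈ F, meshCube r z ⊆ {x | ∀ l, |⟪u l, x - y⟫| ≤ a l + √N * r} := by
    refine Set.iUnion₂_subset fun z hz x hx l => ?_
    obtain ⟨x', hx', h⟩ := hF z hz
    have h1 : ⟪u l, x - y⟫ = ⟪u l, x - x'⟫ + ⟪u l, x' - y⟫ := by
      rw [← inner_add_right, sub_add_sub_cancel]
    have h2 : |⟪u l, x - x'⟫| ≤ √N * r := by
      refine (abs_real_inner_le_norm _ _).trans ?_
      simpa using norm_sub_le_of_mem_meshCube hr hx hx'
    rw [h1]
    linarith [abs_add_le ⟪u l, x - x'⟫ ⟪u l, x' - y⟫, h l]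
  have hvol := measure_mono (μ := volume) hsub
  rw [measure_biUnion_finset (fun z _ z' _ h => pairwise_disjoint_meshCube hr h)
    (fun z _ => measurableSet_meshCube r z), volume_setOf_abs_inner_sub_le] at hvol
  simp only [volume_meshCube, Finset.sum_const, nsmul_eq_mul] at hvol
  have hnn : ∀ l, 0 ≤ 2 * (a l + √N * r) := fun l => by
    have := ha l
    positivity
  rw [← ENNReal.ofReal_prod_of_nonneg (fun l _ => hnn l), ← ENNReal.ofReal_pow hr.le,
    ← ENNReal.ofReal_natCast, ← ENNReal.ofReal_mul (by positivity),
    ENNReal.ofReal_le_ofReal_iff (Finset.prod_nonneg fun l _ => hnn l)] at hvol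
  have hprod : ∏ l, 2 * (a l + √N * r) = (∏ l, 2 * (a l / r + √N)) * r ^ N := by
    have : ∀ l, 2 * (a l + √N * r) = 2 * (a l / r + √N) * r := fun l => by field_simp
    simp only [this]
    rw [Finset.prod_mul_distrib, Finset.prod_const, Finset.card_univ, Fintype.card_fin]
  rw [hprod] at hvol
  exact le_of_mul_le_mul_right hvol (by positivity)

/-- Hölder's inequality for a series with at most `K` nonzero terms. -/
theorem tsum_rpow_le_of_card_le {ι : Type*} (a : ι → ℝ≥0∞) {q : ℝ} (hq : 1 < q) {K : ℝ}
    (hK : ∀ F : Finset ι, (∀ z ∈ F, a z ≠ 0) → (F.card : ℝ) ≤ K) :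
    (∑' z, a z) ^ q ≤ ENNReal.ofReal (K ^ (q - 1)) * ∑' z, a z ^ q := by
  classical
  have hq0 : 0 < q := by linarith
  have hK0 : 0 ≤ K := by simpa using hK ∅ (by simp)
  suffices h : ∑' z, a z ≤ (ENNReal.ofReal (K ^ (q - 1)) * ∑' z, a z ^ q) ^ (1 / q) by
    refine (ENNReal.rpow_le_rpow h hq0.le).trans ?_
    rw [← ENNReal.rpow_mul, one_div_mul_cancel hq0.ne', ENNReal.rpow_one]
  refine ENNReal.summable.tsum_le_of_sum_le fun F => ?_
  rw [one_div, ENNReal.le_rpow_inv_iff hq0, ← Finset.sum_filter_ne_zero]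
  refine (ENNReal.rpow_sum_le_const_mul_sum_rpow _ _ hq.le).trans ?_
  refine mul_le_mul' ?_ (ENNReal.sum_le_tsum _)
  rw [← ENNReal.ofReal_rpow_of_nonneg hK0 (by linarith), ← ENNReal.ofReal_natCast]
  exact ENNReal.rpow_le_rpow (ENNReal.ofReal_le_ofReal (hK _ (by simp))) (by linarith)

/-- A measure carried by an affine image of a ball has moment sums bounded below in terms of the
singular values. -/
theorem measure_univ_rpow_le_momentSum {r q R : ℝ} (hr : 0 < r) (hq : 1 < q) (hR : 0 ≤ R)
    (T : EuclideanSpace ℝ (Fin N) →L[ℝ] EuclideanSpace ℝ (Fin N)) (hT : Function.Injective T)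
    (y : EuclideanSpace ℝ (Fin N)) (ν : Measure (EuclideanSpace ℝ (Fin N)))
    (hν : ν ((fun x => y + T x) '' Metric.closedBall 0 R)ᶜ = 0) :
    ν Set.univ ^ q ≤
      ENNReal.ofReal ((∏ l : Fin N, 2 * (T.toLinearMap.singularValues l * R / r + √N)) ^ (q - 1)) *
        momentSum ν q r := by
  obtain ⟨u, hu⟩ := exists_orthonormalBasis_abs_inner_map_le T.toLinearMap hT
  rw [← iUnion_meshCube hr, measure_iUnion (pairwise_disjoint_meshCube hr)
    (measurableSet_meshCube r)]
  refine tsum_rpow_le_of_card_le _ hq fun F hF =>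
    card_le_of_meshCube_meets_box hr u y
      (fun l => mul_nonneg (LinearMap.singularValues_nonneg _ _) hR) F fun z hz => ?_
  -- A cube of positive measure must meet the set that carries ν.
  have hne : (meshCube r z ∩ (fun x => y + T x) '' Metric.closedBall 0 R).Nonempty := by
    by_contra hemp
    rw [Set.not_nonempty_iff_eq_empty, ← Set.disjoint_iff_inter_eq_empty] at hemp
    exact hF z hz (measure_mono_null hemp.subset_compl_right hν)
  obtain ⟨_, hxz, x, hx, rfl⟩ := hne
  refine ⟨_, hxz, fun l => ?_⟩
  simp only [add_sub_cancel_left]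
  refine (hu l x).trans ?_
  gcongr
  · exact LinearMap.singularValues_nonneg _ _
  · simpa using hx

end MeshCubes

/-! ### Code space: words, cylinders, cut-sets and the projection. -/

section CodeSpace

variable {N m : ℕ}

theorem length_curtail (i : ℕ → Fin m) (k : ℕ) : (curtail i k).length = k := by
  simp [curtail]

theorem curtail_succ (i : ℕ → Fin m) (k : ℕ) : curtail i (k + 1) = curtail i k ++ [i k] := by
  rw [curtail, List.ofFn_succ_last]
  simp [curtail]

theorem curtail_add (i : ℕ → Fin m) (n k : ℕ) :
    curtail i (n + k) = curtail i n ++ curtail (fun l => i (n + l)) k := by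
  rw [curtail, List.ofFn_add]
  simp [curtail]

theorem take_curtail (i : ℕ → Fin m) {n k : ℕ} (h : k ≤ n) :
    (curtail i n).take k = curtail i k := by
  obtain ⟨d, rfl⟩ := Nat.exists_eq_add_of_le h
  rw [curtail_add, List.take_append_of_le_length (by rw [length_curtail]),
    List.take_of_length_le (by rw [length_curtail])]

theorem dropLast_curtail (i : ℕ → Fin m) (n : ℕ) :
    (curtail i n).dropLast = curtail i (n - 1) := by
  rw [List.dropLast_eq_take, length_curtail, take_curtail i (Nat.sub_le n 1)]

theorem continuous_restrict_fin (k : ℕ) :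
    Continuous fun (i : ℕ → Fin m) (l : Fin k) => i l :=
  continuous_pi fun l => continuous_apply (l : ℕ)

theorem measurableSet_cylinder (w : List (Fin m)) : MeasurableSet (cylinder w) :=
  (continuous_restrict_fin w.length).measurable
    (MeasurableSet.of_discrete (s := {f : Fin w.length → Fin m | List.ofFn f = w}))

variable (T : Fin m → EuclideanSpace ℝ (Fin N) →L[ℝ] EuclideanSpace ℝ (Fin N))

theorem wordMap_append (v w : List (Fin m)) :
    wordMap T (v ++ w) = wordMap T v * wordMap T w := by
  simp [wordMap]

theorem norm_wordMap_le {t : ℝ} (ht : ∀ i, ‖T i‖ ≤ t) (w : List (Fin m)) :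
    ‖wordMap T w‖ ≤ t ^ w.length := by
  induction w with
  | nil => simpa [wordMap] using! ContinuousLinearMap.norm_id_le (𝕜 := ℝ)
  | cons i w ih =>
    have h0 : 0 ≤ t := (norm_nonneg _).trans (ht i)
    have h : wordMap T (i :: w) = T i * wordMap T w := by simp [wordMap]
    rw [h, List.length_cons, pow_succ']
    exact (norm_mul_le _ _).trans (mul_le_mul (ht i) ih (norm_nonneg _) h0)

theorem injective_wordMap (hT : ∀ i, (T i).det ≠ 0) (w : List (Fin m)) :
    Function.Injective (wordMap T w) := by
  induction w with
  | nil => simpa [wordMap] using Function.injective_id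
  | cons i w ih =>
    have h : wordMap T (i :: w) = T i * wordMap T w := by simp [wordMap]
    rw [h]
    exact ((T i).toContinuousLinearEquivOfDetNeZero (hT i)).injective.comp ih

theorem exists_norm_le_lt_one (hT : ∀ i, ‖T i‖ < 1) :
    ∃ t : ℝ, 0 ≤ t ∧ t < 1 ∧ ∀ i, ‖T i‖ ≤ t := by
  refine ⟨(Finset.univ.sup fun i => ‖T i‖₊ : NNReal), NNReal.coe_nonneg _, ?_, fun i => ?_⟩
  · rw [← NNReal.coe_one, NNReal.coe_lt_coe, Finset.sup_lt_iff (by simp)]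
    exact fun i _ => hT i
  · exact Finset.le_sup (f := fun i => ‖T i‖₊) (Finset.mem_univ i)

/-- Composing on the right with one of finitely many non-singular maps decreases the singular
values by at most a constant factor. -/
theorem exists_mul_singularValues_le (hT : ∀ i, (T i).det ≠ 0) :
    ∃ c : ℝ, 0 < c ∧ c ≤ 1 ∧
      ∀ (A : EuclideanSpace ℝ (Fin N) →L[ℝ] EuclideanSpace ℝ (Fin N)) (i : Fin m) (k : ℕ),
        c * A.toLinearMap.singularValues k ≤ (A * T i).toLinearMap.singularValues k := by
  let S : Fin m → EuclideanSpace ℝ (Fin N) →L[ℝ] EuclideanSpace ℝ (Fin N) := fun i =>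
    ((T i).toContinuousLinearEquivOfDetNeZero (hT i)).symm
  have hTS : ∀ i, T i * S i = 1 := fun i => by
    ext1 x
    exact ((T i).toContinuousLinearEquivOfDetNeZero (hT i)).apply_symm_apply x
  have hsum : 0 ≤ ∑ i, ‖S i‖ := Finset.sum_nonneg fun i _ => norm_nonneg _
  -- From A = (A T_i) S_i one gets σ_k(A) ≤ σ_k(A T_i)‖S_i‖. The summand 1 ensures c ≤ 1 and
  -- positivity of the denominator.
  refine ⟨(1 + ∑ i, ‖S i‖)⁻¹, by positivity, inv_le_one_of_one_le₀ (by linarith),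
    fun A i k => ?_⟩
  rw [inv_mul_le_iff₀ (by positivity), mul_comm]
  have h := singularValues_comp_le (A * T i) (S i) k
  rw [mul_assoc, hTS, mul_one] at h
  refine h.trans (mul_le_mul_of_nonneg_left ?_ (LinearMap.singularValues_nonneg _ _))
  linarith [Finset.single_le_sum (f := fun i => ‖S i‖) (fun i _ => norm_nonneg _)
    (Finset.mem_univ i)]

theorem antitone_singularValues_curtail (hT : ∀ i, ‖T i‖ < 1) (i : ℕ → Fin m) (k : ℕ) :
    Antitone fun n => (wordMap T (curtail i n)).toLinearMap.singularValues k := by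
  refine antitone_nat_of_succ_le fun n => ?_
  rw [curtail_succ, wordMap_append]
  refine (singularValues_comp_le _ _ k).trans
    (mul_le_of_le_one_right (LinearMap.singularValues_nonneg _ _) ?_)
  simpa [wordMap] using (hT (i n)).le

/-- Along a fixed infinite word α_j is non-increasing in the length, so it passes the level r at one
length at most. -/
theorem pairwise_disjoint_cylinder_cutSet (hT : ∀ i, ‖T i‖ < 1) (s r : ℝ) :
    Pairwise (Function.onFun Disjoint
      fun w : cutSet T s r => cylinder (w : List (Fin m))) := by
  have key : ∀ w ∈ cutSet T s r, ∀ w' ∈ cutSet T s r, ∀ i ∈ cylinder w, i ∈ cylinder w' →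
      w'.length ≤ w.length := by
    intro w hw w' hw' i hi hi'
    by_contra! hlt
    have h1 := hw.1
    have h2 := hw'.2
    rw [← show curtail i _ = w from hi] at h1
    rw [← show curtail i _ = w' from hi', dropLast_curtail] at h2
    -- If w is the shorter prefix, it is no longer than w' without its last letter, where α_j still
    -- exceeds r; but α_j(T_w) ≤ r.
    exact (h1.trans_lt h2).not_ge
      (antitone_singularValues_curtail T hT i (svIndex N s - 1) (Nat.le_sub_one_of_lt hlt))
  intro w w' hww
  refine Set.disjoint_left.mpr fun i hi hi' => hww (Subtype.ext ?_)
  have hlen := le_antisymm (key _ w'.2 _ w.2 i hi' hi) (key _ w.2 _ w'.2 i hi hi')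
  rw [← show curtail i _ = (w : List (Fin m)) from hi,
    ← show curtail i _ = (w' : List (Fin m)) from hi', hlen]

variable (ω : List (Fin m) → EuclideanSpace ℝ (Fin N))

theorem norm_wordMap_curtail_apply_le {t B : ℝ} (ht : ∀ i, ‖T i‖ ≤ t)
    (hB : ∀ w, ‖ω w‖ ≤ B) (i : ℕ → Fin m) (w : List (Fin m)) (k : ℕ) :
    ‖wordMap T (curtail i k) (ω w)‖ ≤ B * t ^ k := by
  refine (ContinuousLinearMap.le_opNorm _ _).trans ?_
  rw [mul_comm]
  have h := norm_wordMap_le T ht (curtail i k)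
  rw [length_curtail] at h
  exact mul_le_mul (hB w) h (norm_nonneg _) ((norm_nonneg _).trans (hB w))

/-- The series converges uniformly and each term depends on finitely many letters. Continuity
provides the measurability needed to push μ forward. -/
theorem continuous_projection {t B : ℝ} (ht : ∀ i, ‖T i‖ ≤ t) (ht0 : 0 ≤ t) (ht1 : t < 1)
    (hB : ∀ w, ‖ω w‖ ≤ B) : Continuous (projection T ω) := by
  refine continuous_tsum (fun k => ?_)
    ((summable_geometric_of_lt_one ht0 ht1).mul_left B)
    (fun k i => norm_wordMap_curtail_apply_le T ω ht hB i _ k)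
  have h : (fun i : ℕ → Fin m => wordMap T (curtail i k) (ω (curtail i (k + 1)))) =
      (fun f : Fin (k + 1) → Fin m => wordMap T ((List.ofFn f).take k) (ω (List.ofFn f))) ∘
        fun i l => i l := by
    ext1 i
    simp only [Function.comp_apply]
    rw [← take_curtail i k.le_succ]
    rfl
  rw [h]
  exact continuous_of_discreteTopology.comp (continuous_restrict_fin (k + 1))

/-- The projection maps each cylinder into an affine image of a fixed ball. -/
theorem exists_projection_mem_image_closedBall {t B : ℝ} (ht : ∀ i, ‖T i‖ ≤ t) (ht0 : 0 ≤ t)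
    (ht1 : t < 1) (hB : ∀ w, ‖ω w‖ ≤ B) (w : List (Fin m)) :
    ∃ y, ∀ i ∈ cylinder w, projection T ω i ∈
      (fun x => y + wordMap T w x) '' Metric.closedBall 0 (B * (1 - t)⁻¹) := by
  -- The first |w| terms of the series depend on w alone and form the translation; T_w factors out
  -- of the tail, which is dominated by a geometric series.
  refine ⟨∑ k ∈ Finset.range w.length, wordMap T (w.take k) (ω (w.take (k + 1))),
    fun i hi => ?_⟩
  have hw : curtail i w.length = w := hi
  have hgeo : HasSum (fun k : ℕ => B * t ^ k) (B * (1 - t)⁻¹) :=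
    (hasSum_geometric_of_lt_one ht0 ht1).mul_left B
  have hsum : Summable fun k => wordMap T (curtail i k) (ω (curtail i (k + 1))) :=
    Summable.of_norm_bounded hgeo.summable
      fun k => norm_wordMap_curtail_apply_le T ω ht hB i _ k
  have hbound : ∀ k, ‖wordMap T (curtail (fun l => i (w.length + l)) k)
      (ω (curtail i (w.length + k + 1)))‖ ≤ B * t ^ k :=
    fun k => norm_wordMap_curtail_apply_le T ω ht hB _ _ k
  refine ⟨∑' k, wordMap T (curtail (fun l => i (w.length + l)) k)
    (ω (curtail i (w.length + k + 1))), ?_, ?_⟩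
  · rw [mem_closedBall_zero_iff]
    exact tsum_of_norm_bounded hgeo hbound
  · simp only
    rw [projection, ← hsum.sum_add_tsum_nat_add w.length,
      ContinuousLinearMap.map_tsum _ (Summable.of_norm_bounded hgeo.summable hbound)]
    congr 1
    · refine Finset.sum_congr rfl fun k hk => ?_
      have hk' := Finset.mem_range.mp hk
      rw [← take_curtail i hk'.le, ← take_curtail i (Nat.succ_le_of_lt hk'), hw]
    · refine tsum_congr fun k => ?_
      rw [add_comm k w.length, curtail_add i w.length k, hw, wordMap_append]
      rfl

end CodeSpace

/-! ### Comparison of cut-set sums with moment sums. -/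

section Estimates

variable {N m : ℕ}

theorem svIndex_bounds {s : ℝ} (hs : 0 < s) (hsN : s ≤ N) :
    ∃ p < N, svIndex N s = p + 1 ∧ (p : ℝ) < s ∧ s ≤ p + 1 := by
  have h1 : 0 < ⌈s⌉₊ := Nat.ceil_pos.mpr hs
  have h2 : ⌈s⌉₊ ≤ N := Nat.ceil_le.mpr hsN
  refine ⟨⌈s⌉₊ - 1, by omega, by rw [svIndex]; omega, ?_, ?_⟩
  · exact Nat.lt_ceil.mp (by omega)
  · have h3 : ((⌈s⌉₊ - 1 : ℕ) : ℝ) + 1 = ⌈s⌉₊ := by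
      rw [← Nat.cast_add_one, Nat.sub_add_cancel h1]
    rw [h3]
    exact Nat.le_ceil s

theorem svFun_eq (A : EuclideanSpace ℝ (Fin N) →L[ℝ] EuclideanSpace ℝ (Fin N)) {s : ℝ} {p : ℕ}
    (hsN : s ≤ N) (hp : svIndex N s = p + 1) :
    svFun A s = (∏ l ∈ Finset.range p, A.toLinearMap.singularValues l) *
      A.toLinearMap.singularValues p ^ (s - p) := by
  rw [svFun, if_pos hsN, hp, Finset.prod_Ico_eq_prod_range]
  simp [sv, sub_add]

/-- The number of mesh cubes meeting the image of a ball under `A` is at most a constant times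
`φ^s(A) r^{-s}` when the `j`-th singular value is comparable to `r`. -/
theorem prod_le_mul_svFun {s c R r : ℝ} (hs : 0 < s) (hsN : s ≤ N) (hc : 0 < c) (hc1 : c ≤ 1)
    (hR : 0 ≤ R) (hr : 0 < r)
    (A : EuclideanSpace ℝ (Fin N) →L[ℝ] EuclideanSpace ℝ (Fin N))
    (hA : sv A (svIndex N s) ≤ r) (hA' : c * r ≤ sv A (svIndex N s)) :
    ∏ l : Fin N, 2 * (A.toLinearMap.singularValues l * R / r + √N) ≤
      (2 * (R + √N / c)) ^ N / c * (svFun A s * r ^ (-s)) := by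
  obtain ⟨p, hpN, hp, hps, hsp⟩ := svIndex_bounds hs hsN
  set σ := A.toLinearMap.singularValues with hσ
  have hσ0 : ∀ l, 0 ≤ σ l := LinearMap.singularValues_nonneg _
  have hanti : Antitone σ := LinearMap.singularValues_antitone _
  have hsv : sv A (svIndex N s) = σ p := by rw [hp, sv, Nat.add_sub_cancel]
  rw [hsv] at hA hA'
  set G := 2 * (R + √N / c) with hG
  have hG0 : 0 ≤ G := by positivity
  have hdiv : √N ≤ √N / c := le_div_self (Real.sqrt_nonneg _) hc hc1
  -- With p = j-1 in zero-based indexing: for l < p, σ_l/r ≥ c, so √N is absorbed into a multiple of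
  -- σ_l/r; for l ≥ p, σ_l ≤ r and the factor is bounded.
  have hfac : ∀ l : ℕ, 2 * (σ l * R / r + √N) ≤ G * if l < p then σ l / r else 1 := by
    intro l
    split_ifs with hl
    · have h1 : c ≤ σ l / r := by
        rw [le_div_iff₀ hr]
        exact hA'.trans (hanti hl.le)
      have h2 : √N ≤ √N / c * (σ l / r) := by
        rw [div_mul_eq_mul_div, le_div_iff₀ hc]
        gcongr
      have h3 : σ l * R / r = R * (σ l / r) := by ring
      rw [h3, hG]
      linarith
    · have h1 : σ l / r ≤ 1 := by
        rw [div_le_one hr]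
        exact (hanti (not_lt.mp hl)).trans hA
      have h3 : σ l * R / r = R * (σ l / r) := by ring
      have h4 : R * (σ l / r) ≤ R := mul_le_of_le_one_right hR h1
      rw [h3, hG, mul_one]
      linarith
  have hprod : ∏ l : Fin N, 2 * (σ l * R / r + √N) ≤
      G ^ N * ((∏ l ∈ Finset.range p, σ l) / r ^ p) := by
    refine (Finset.prod_le_prod (fun (l : Fin N) _ => ?_) fun (l : Fin N) _ => hfac l).trans ?_
    · have := hσ0 l
      positivity
    · rw [Finset.prod_mul_distrib, Finset.prod_const, Finset.card_univ, Fintype.card_fin,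
        Fin.prod_univ_eq_prod_range (fun l => if l < p then σ l / r else 1) N,
        ← Finset.prod_filter]
      have : (Finset.range N).filter (· < p) = Finset.range p := by
        ext l
        simp only [Finset.mem_filter, Finset.mem_range]
        omega
      rw [this, Finset.prod_div_distrib, Finset.prod_const, Finset.card_range]
  refine hprod.trans ?_
  rw [svFun_eq A hsN hp, ← hσ, div_mul_eq_mul_div, le_div_iff₀ hc, mul_assoc]
  refine mul_le_mul_of_nonneg_left ?_ (pow_nonneg hG0 N)
  -- Since 0 < s - p ≤ 1 and c ≤ 1, the power c^{s-p} is at least c; this is the source of the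
  -- division by c in the constant.
  have hpow : c * r ^ (s - p) ≤ σ p ^ (s - p) := by
    calc c * r ^ (s - p) ≤ c ^ (s - p) * r ^ (s - p) := by
          gcongr
          exact Real.self_le_rpow_of_le_one hc.le hc1 (by linarith)
      _ = (c * r) ^ (s - p) := (Real.mul_rpow hc.le hr.le).symm
      _ ≤ σ p ^ (s - p) := Real.rpow_le_rpow (by positivity) hA' (by linarith)
  have hr' : r ^ (s - p) * r ^ (-s) = (r ^ p)⁻¹ := by
    rw [← Real.rpow_add hr, ← Real.rpow_natCast, ← Real.rpow_neg hr.le]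
    congr 1
    ring
  calc (∏ l ∈ Finset.range p, σ l) / r ^ p * c
      = (∏ l ∈ Finset.range p, σ l) * ((c * r ^ (s - p)) * r ^ (-s)) := by
        rw [mul_assoc c, hr', div_eq_mul_inv]
        ring
    _ ≤ (∏ l ∈ Finset.range p, σ l) * (σ p ^ (s - p) * r ^ (-s)) := by
        have := Finset.prod_nonneg fun l (_ : l ∈ Finset.range p) => hσ0 l
        gcongr
    _ = _ := by ring

variable (T : Fin m → EuclideanSpace ℝ (Fin N) →L[ℝ] EuclideanSpace ℝ (Fin N))
  (ω : List (Fin m) → EuclideanSpace ℝ (Fin N)) (μ : Measure (ℕ → Fin m))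

theorem measure_cylinder_rpow_le {t B r q : ℝ} (ht : ∀ i, ‖T i‖ ≤ t) (ht0 : 0 ≤ t)
    (ht1 : t < 1) (hB : ∀ w, ‖ω w‖ ≤ B) (hT : ∀ i, (T i).det ≠ 0) (hr : 0 < r) (hq : 1 < q)
    (w : List (Fin m)) :
    μ (cylinder w) ^ q ≤
      ENNReal.ofReal ((∏ l : Fin N, 2 * ((wordMap T w).toLinearMap.singularValues l *
        (B * (1 - t)⁻¹) / r + √N)) ^ (q - 1)) *
        momentSum (projMeasure T ω (μ.restrict (cylinder w))) q r := by
  have hproj := (continuous_projection T ω ht ht0 ht1 hB).measurable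
  have hB0 : 0 ≤ B := (norm_nonneg _).trans (hB [])
  have h1t : 0 < 1 - t := by linarith
  obtain ⟨y, hy⟩ := exists_projection_mem_image_closedBall T ω ht ht0 ht1 hB w
  have huniv : projMeasure T ω (μ.restrict (cylinder w)) Set.univ = μ (cylinder w) := by
    rw [projMeasure, Measure.map_apply hproj MeasurableSet.univ]
    simp
  rw [← huniv]
  refine measure_univ_rpow_le_momentSum hr hq (by positivity) _ (injective_wordMap T hT w) y _ ?_
  have hmeas : MeasurableSet
      ((fun x => y + wordMap T w x) '' Metric.closedBall 0 (B * (1 - t)⁻¹)) :=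
    ((isCompact_closedBall _ _).image (by fun_prop)).measurableSet
  rw [projMeasure, Measure.map_apply hproj hmeas.compl,
    Measure.restrict_apply (hproj hmeas.compl)]
  convert measure_empty (μ := μ)
  ext i
  simp only [Set.mem_inter_iff, Set.mem_preimage, Set.mem_compl_iff, Set.mem_empty_iff_false,
    iff_false, not_and]
  exact fun h hi => h (hy i hi)

/-- Write x^q = x · x^{q-1} and bound the second factor of each term by the whole sum to the power
q-1. -/
theorem tsum_rpow_le_rpow_tsum {ι : Type*} (a : ι → ℝ≥0∞) {q : ℝ} (hq : 1 ≤ q) :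
    ∑' i, a i ^ q ≤ (∑' i, a i) ^ q := by
  have hsplit : ∀ x : ℝ≥0∞, x ^ q = x * x ^ (q - 1) := fun x => by
    nth_rewrite 2 [← ENNReal.rpow_one x]
    rw [← ENNReal.rpow_add_of_nonneg _ _ zero_le_one (by linarith), add_sub_cancel]
  rw [hsplit (∑' i, a i), ← ENNReal.tsum_mul_right]
  refine ENNReal.tsum_le_tsum fun i => ?_
  rw [hsplit]
  exact mul_le_mul' le_rfl (ENNReal.rpow_le_rpow (ENNReal.le_tsum i) (by linarith))

theorem tsum_momentSum_restrict_le {ι : Type*} [Countable ι] {C : ι → Set (ℕ → Fin m)}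
    (hC : ∀ w, MeasurableSet (C w)) (hdisj : Pairwise (Function.onFun Disjoint C))
    (hproj : Measurable (projection T ω)) {q : ℝ} (hq : 1 ≤ q) (r : ℝ) :
    ∑' w, momentSum (projMeasure T ω (μ.restrict (C w))) q r ≤
      momentSum (projMeasure T ω μ) q r := by
  unfold momentSum
  rw [ENNReal.tsum_comm]
  refine ENNReal.tsum_le_tsum fun z => (tsum_rpow_le_rpow_tsum _ hq).trans ?_
  refine ENNReal.rpow_le_rpow ?_ (by linarith)
  have hpre := hproj (measurableSet_meshCube r z)
  have h : ∀ w, projMeasure T ω (μ.restrict (C w)) (meshCube r z) =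
      μ (projection T ω ⁻¹' meshCube r z ∩ C w) := fun w => by
    rw [projMeasure, Measure.map_apply hproj (measurableSet_meshCube r z),
      Measure.restrict_apply hpre]
  simp only [h]
  rw [projMeasure, Measure.map_apply hproj (measurableSet_meshCube r z),
    ← measure_iUnion
      (fun w w' hw => (hdisj hw).mono Set.inter_subset_right Set.inter_subset_right)
      (fun w => hpre.inter (hC w))]
  exact measure_mono (Set.iUnion_subset fun w => Set.inter_subset_left)

/-- The cut-set sums are controlled by the moment sums of the projected measure. -/
theorem exists_cutSum_le {B q s : ℝ} (hTc : ∀ i, ‖T i‖ < 1) (hT : ∀ i, (T i).det ≠ 0)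
    (hB : ∀ w, ‖ω w‖ ≤ B) (hq : 1 < q) (hs : 0 < s) (hsN : s ≤ N) :
    ∃ C : ℝ, ∀ r > 0, cutSum T μ q s r ≤
      ENNReal.ofReal (C * r ^ (-(s * (q - 1)))) * momentSum (projMeasure T ω μ) q r := by
  obtain ⟨t, ht0, ht1, ht⟩ := exists_norm_le_lt_one T hTc
  obtain ⟨c, hc, hc1, hcT⟩ := exists_mul_singularValues_le T hT
  have hB0 : 0 ≤ B := (norm_nonneg _).trans (hB [])
  have h1t : 0 < 1 - t := by linarith
  set R := B * (1 - t)⁻¹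
  have hR : 0 ≤ R := by positivity
  set K := (2 * (R + √N / c)) ^ N / c
  have hK : 0 ≤ K := by positivity
  have hproj := (continuous_projection T ω ht ht0 ht1 hB).measurable
  refine ⟨K ^ (q - 1), fun r hr => ?_⟩
  refine le_trans ?_ (mul_le_mul_right (tsum_momentSum_restrict_le T ω μ
    (fun w : cutSet T s r => measurableSet_cylinder (w : List (Fin m)))
    (pairwise_disjoint_cylinder_cutSet T hTc s r) hproj hq.le r) _)
  rw [cutSum, ← ENNReal.tsum_mul_left]
  refine ENNReal.tsum_le_tsum fun w => ?_
  obtain ⟨w, hw, hw'⟩ := w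
  simp only
  -- Before its last letter the word has α_j > r, and that letter costs at most the factor c. The
  -- empty word is not in the cut-set.
  have hlow : c * r ≤ sv (wordMap T w) (svIndex N s) := by
    rcases List.eq_nil_or_concat w with rfl | ⟨v, i, rfl⟩
    · exact absurd (hw'.trans_le hw) (by simp)
    · simp only [List.concat_eq_append, List.dropLast_concat] at hw' ⊢
      rw [wordMap_append]
      have h1 := hcT (wordMap T v) i (svIndex N s - 1)
      have h2 : wordMap T [i] = T i := by simp [wordMap]
      rw [h2]
      exact (mul_le_mul_of_nonneg_left hw'.le hc.le).trans h1
  have hprod := prod_le_mul_svFun hs hsN hc hc1 hR hr (wordMap T w) hw hlow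
  -- Positivity lets φ^s(T_w)^{1-q} cancel the φ^s(T_w)^{q-1} produced by Hölder's inequality.
  have hpos : 0 < svFun (wordMap T w) s := by
    obtain ⟨p, hpN, hp, -, -⟩ := svIndex_bounds hs hsN
    have hσ := (LinearMap.injective_iff_forall_lt_finrank_singularValues_pos
      (wordMap T w).toLinearMap).mp (injective_wordMap T hT w)
    simp only [finrank_euclideanSpace, Fintype.card_fin] at hσ
    rw [svFun_eq _ hsN hp]
    exact mul_pos (Finset.prod_pos fun l hl => hσ l ((Finset.mem_range.mp hl).trans hpN))
      (Real.rpow_pos_of_pos (hσ p hpN) _)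
  refine (mul_le_mul_right
    (measure_cylinder_rpow_le T ω μ ht ht0 ht1 hB hT hr hq w) _).trans ?_
  rw [← mul_assoc]
  refine mul_le_mul_left ?_ _
  rw [← ENNReal.ofReal_mul (Real.rpow_nonneg hpos.le _)]
  refine ENNReal.ofReal_le_ofReal ?_
  have hq1 : 0 ≤ q - 1 := by linarith
  calc _ ≤ svFun (wordMap T w) s ^ (1 - q) *
        (K * (svFun (wordMap T w) s * r ^ (-s))) ^ (q - 1) := by
        refine mul_le_mul_of_nonneg_left (Real.rpow_le_rpow ?_ hprod hq1)
          (Real.rpow_nonneg hpos.le _)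
        refine Finset.prod_nonneg fun l _ => ?_
        have := LinearMap.singularValues_nonneg (wordMap T w).toLinearMap l
        positivity
    _ = K ^ (q - 1) * r ^ (-(s * (q - 1))) := by
        rw [Real.mul_rpow hK (by positivity), Real.mul_rpow hpos.le (by positivity),
          ← Real.rpow_mul hr.le, neg_mul, show 1 - q = -(q - 1) by ring, Real.rpow_neg hpos.le]
        have := (Real.rpow_pos_of_pos hpos (q - 1)).ne'
        field_simp

/-- The moment sums of the projected measure are at least of order `r^{N(q-1)}`. -/
theorem exists_le_momentSum {B q : ℝ} (hTc : ∀ i, ‖T i‖ < 1) (hT : ∀ i, (T i).det ≠ 0)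
    (hB : ∀ w, ‖ω w‖ ≤ B) (hq : 1 < q) [IsFiniteMeasure μ] (hμ : μ ≠ 0) :
    ∃ c > 0, ∀ r > 0, r ≤ 1 →
      ENNReal.ofReal (c * r ^ (N * (q - 1))) ≤ momentSum (projMeasure T ω μ) q r := by
  obtain ⟨t, ht0, ht1, ht⟩ := exists_norm_le_lt_one T hTc
  have hB0 : 0 ≤ B := (norm_nonneg _).trans (hB [])
  have h1t : 0 < 1 - t := by linarith
  set R := B * (1 - t)⁻¹
  have hR : 0 ≤ R := by positivity
  have hcyl : cylinder ([] : List (Fin m)) = Set.univ := by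
    ext i
    simp [cylinder, curtail]
  have hμ0 : 0 < μ.real Set.univ := by
    rw [measureReal_def]
    exact ENNReal.toReal_pos (by simpa using hμ) (measure_ne_top _ _)
  have hone : ∀ l, (wordMap T []).toLinearMap.singularValues l ≤
      (1 : EuclideanSpace ℝ (Fin N) →L[ℝ] EuclideanSpace ℝ (Fin N)).toLinearMap.singularValues 0 :=
    fun l => LinearMap.singularValues_antitone _ (Nat.zero_le l)
  set σ :=
    (1 : EuclideanSpace ℝ (Fin N) →L[ℝ] EuclideanSpace ℝ (Fin N)).toLinearMap.singularValues 0
  have hσ : 0 ≤ σ := LinearMap.singularValues_nonneg _ _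
  -- The summand 1 keeps `G` positive even when N = 0.
  set G := 2 * (σ * R + √N) + 1
  have hG : 0 < G := by positivity
  have hq1 : 0 ≤ q - 1 := by linarith
  refine ⟨μ.real Set.univ ^ q / (G ^ N) ^ (q - 1), by positivity, fun r hr hr1 => ?_⟩
  have h := measure_cylinder_rpow_le T ω μ ht ht0 ht1 hB hT hr hq []
  rw [hcyl, Measure.restrict_univ] at h
  have hle : (∏ l : Fin N, 2 * ((wordMap T []).toLinearMap.singularValues l * R / r + √N)) ^
      (q - 1) ≤ (G ^ N) ^ (q - 1) * (r ^ (N * (q - 1)))⁻¹ := by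
    have h0 : ∀ l : Fin N, 0 ≤ 2 * ((wordMap T []).toLinearMap.singularValues l * R / r + √N) :=
      fun l => by
        have := LinearMap.singularValues_nonneg (wordMap T []).toLinearMap l
        positivity
    have h1 : ∏ l : Fin N, 2 * ((wordMap T []).toLinearMap.singularValues l * R / r + √N) ≤
        G ^ N * (r ^ N)⁻¹ := by
      rw [← inv_pow, ← mul_pow]
      refine (Finset.prod_le_prod (fun l _ => h0 l) (g := fun _ => G * r⁻¹)
        fun l _ => ?_).trans (by simp)
      rw [← div_eq_mul_inv, le_div_iff₀ hr]
      calc 2 * ((wordMap T []).toLinearMap.singularValues l * R / r + √N) * r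
          = 2 * ((wordMap T []).toLinearMap.singularValues l * R + √N * r) := by field_simp
        _ ≤ 2 * (σ * R + √N * 1) := by
          gcongr
          exact hone l
        _ ≤ G := by rw [mul_one]; exact le_add_of_nonneg_right zero_le_one
    refine (Real.rpow_le_rpow (Finset.prod_nonneg fun l _ => h0 l) h1 hq1).trans_eq ?_
    rw [Real.mul_rpow (by positivity) (by positivity), Real.inv_rpow (by positivity),
      ← Real.rpow_natCast r N, ← Real.rpow_mul hr.le]
  have hGq : 0 < (G ^ N) ^ (q - 1) := by positivity
  have hrq : 0 < r ^ (N * (q - 1)) := by positivity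
  have h2 : ENNReal.ofReal (μ.real Set.univ ^ q) ≤
      ENNReal.ofReal ((G ^ N) ^ (q - 1) * (r ^ (N * (q - 1)))⁻¹) *
        momentSum (projMeasure T ω μ) q r := by
    rw [← ENNReal.ofReal_rpow_of_nonneg hμ0.le (by linarith), ofReal_measureReal]
    exact h.trans (mul_le_mul_left (ENNReal.ofReal_le_ofReal hle) _)
  have h3 := mul_le_mul_right h2 (ENNReal.ofReal (r ^ (N * (q - 1)) / (G ^ N) ^ (q - 1)))
  rw [← mul_assoc, ← ENNReal.ofReal_mul (by positivity), ← ENNReal.ofReal_mul (by positivity)]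
    at h3
  have h4 : r ^ (N * (q - 1)) / (G ^ N) ^ (q - 1) *
      ((G ^ N) ^ (q - 1) * (r ^ (N * (q - 1)))⁻¹) = 1 := by
    field_simp
  rw [h4, ENNReal.ofReal_one, one_mul] at h3
  refine le_trans (ENNReal.ofReal_le_ofReal (le_of_eq ?_)) h3
  ring

end Estimates

/-! ### Passage to the limit r → 0. -/

section Limits

variable {N m : ℕ}

/-- As log r < 0, a lower bound for the moment sum becomes an upper bound for the quotient defining
the dimensions. -/
theorem log_div_le_of_rpow_le {q r s : ℝ} {M : ℝ≥0∞} (hq : 1 < q) (hr : 0 < r) (hr1 : r < 1)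
    (h : ENNReal.ofReal (r ^ (s * (q - 1))) ≤ M) :
    ENNReal.log M / (((q - 1) * Real.log r : ℝ) : EReal) ≤ s := by
  have hneg : (q - 1) * Real.log r < 0 :=
    mul_neg_of_pos_of_neg (by linarith) (Real.log_neg hr hr1)
  have hlog := ENNReal.log_le_log h
  rw [ENNReal.log_ofReal_of_pos (Real.rpow_pos_of_pos hr _), Real.log_rpow hr] at hlog
  refine (EReal.div_le_div_right_of_nonpos (by exact_mod_cast hneg.le) hlog).trans_eq ?_
  rw [← EReal.coe_div, mul_assoc, mul_div_cancel_right₀ _ hneg.ne]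

theorem lowerDim_le_upperDim (q : ℝ) (τ : Measure (EuclideanSpace ℝ (Fin N))) :
    lowerDim q τ ≤ upperDim q τ :=
  liminf_le_limsup

variable (T : Fin m → EuclideanSpace ℝ (Fin N) →L[ℝ] EuclideanSpace ℝ (Fin N))
  (ω : List (Fin m) → EuclideanSpace ℝ (Fin N)) (μ : Measure (ℕ → Fin m))

theorem upperDim_projMeasure_le {B q : ℝ} (hTc : ∀ i, ‖T i‖ < 1) (hT : ∀ i, (T i).det ≠ 0)
    (hB : ∀ w, ‖ω w‖ ≤ B) (hq : 1 < q) [IsFiniteMeasure μ] (hμ : μ ≠ 0) :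
    upperDim q (projMeasure T ω μ) ≤ ((N : ℝ) : EReal) := by
  obtain ⟨c, hc, hM⟩ := exists_le_momentSum T ω μ hTc hT hB hq hμ
  refine EReal.le_of_forall_lt_iff_le.mp fun s hs => ?_
  have hs' : (N : ℝ) < s := by exact_mod_cast hs
  have hexp : 0 < (s - N) * (q - 1) := mul_pos (by linarith) (by linarith)
  -- For s > N the surplus power r^{(s-N)(q-1)} tends to 0 and so absorbs the constant c.
  have hsmall : ∀ᶠ r : ℝ in 𝓝[>] 0, r ^ ((s - N) * (q - 1)) < c := by
    have h := (Real.continuousAt_rpow_const 0 ((s - N) * (q - 1)) (Or.inr hexp.le)).tendsto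
    rw [Real.zero_rpow hexp.ne'] at h
    exact (h.mono_left nhdsWithin_le_nhds).eventually_lt_const hc
  refine limsup_le_of_le (by isBoundedDefault) ?_
  filter_upwards [hsmall, Ioo_mem_nhdsGT one_pos] with r hrc hr
  refine log_div_le_of_rpow_le hq hr.1 hr.2 (le_trans (ENNReal.ofReal_le_ofReal ?_)
    (hM r hr.1 hr.2.le))
  have hsplit : s * (q - 1) = (s - N) * (q - 1) + N * (q - 1) := by ring
  rw [hsplit, Real.rpow_add hr.1]
  exact mul_le_mul_of_nonneg_right hrc.le (Real.rpow_nonneg hr.1.le _)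

theorem exists_cutSum_le_of_lt_log_div {B q s : ℝ} (hTc : ∀ i, ‖T i‖ < 1)
    (hT : ∀ i, (T i).det ≠ 0) (hB : ∀ w, ‖ω w‖ ≤ B) (hq : 1 < q) (hs : 0 < s) (hsN : s ≤ N) :
    ∃ C : ℝ, ∀ r : ℝ, 0 < r → r < 1 →
      (s : EReal) < ENNReal.log (momentSum (projMeasure T ω μ) q r) /
        (((q - 1) * Real.log r : ℝ) : EReal) →
      cutSum T μ q s r ≤ ENNReal.ofReal C := by
  obtain ⟨C, hC⟩ := exists_cutSum_le T ω μ hTc hT hB hq hs hsN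
  refine ⟨C, fun r hr hr1 hlt => (hC r hr).trans ?_⟩
  have hM : momentSum (projMeasure T ω μ) q r ≤ ENNReal.ofReal (r ^ (s * (q - 1))) := by
    by_contra! h
    exact hlt.not_ge (log_div_le_of_rpow_le hq hr hr1 h.le)
  refine (mul_le_mul_right hM _).trans_eq ?_
  rw [← ENNReal.ofReal_mul' (by positivity), mul_assoc, ← Real.rpow_add hr]
  simp

/-- Because L ≤ n, any real strictly between d and L is at most n. Applied with n = N, this avoids
the branch s > N of φ^s. -/
theorem le_coe_of_forall_between {L : EReal} {d : ℝ≥0∞} {n : ℝ} (hLn : L ≤ n)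
    (h : ∀ s : ℝ, 0 < s → s ≤ n → (s : EReal) < L → ENNReal.ofReal s ≤ d) : L ≤ d := by
  by_contra! hlt
  obtain ⟨s, hds, hsL⟩ := EReal.lt_iff_exists_real_btwn.mp hlt
  have hs : 0 < s := by
    have h0 : ((0 : ℝ) : EReal) < s := (EReal.coe_ennreal_nonneg d).trans_lt hds
    exact_mod_cast h0
  have hsn : s ≤ n := by exact_mod_cast (hsL.trans_le hLn).le
  have hle := EReal.coe_ennreal_le_coe_ennreal_iff.mpr (h s hs hsn hsL)
  rw [EReal.coe_ennreal_ofReal, max_eq_left hs.le] at hle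
  exact hds.not_ge hle

theorem le_coe_min_natCast {L : EReal} {d : ℝ≥0∞} (hd : L ≤ d) (hN : L ≤ ((N : ℝ) : EReal)) :
    L ≤ ((min d (N : ℝ≥0∞) : ℝ≥0∞) : EReal) := by
  rcases le_total d (N : ℝ≥0∞) with h | h
  · rwa [min_eq_left h]
  · rw [min_eq_right h]
    rwa [← ENNReal.ofReal_natCast, EReal.coe_ennreal_ofReal, max_eq_left (Nat.cast_nonneg N)]

theorem lowerDim_projMeasure_le_dMinus {B q : ℝ} (hTc : ∀ i, ‖T i‖ < 1)
    (hT : ∀ i, (T i).det ≠ 0) (hB : ∀ w, ‖ω w‖ ≤ B) (hq : 1 < q)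
    (hN : lowerDim q (projMeasure T ω μ) ≤ ((N : ℝ) : EReal)) :
    lowerDim q (projMeasure T ω μ) ≤ dMinus T μ q := by
  refine le_coe_of_forall_between hN fun s hs hsN hsL => ?_
  obtain ⟨C, hC⟩ := exists_cutSum_le_of_lt_log_div T ω μ hTc hT hB hq hs hsN
  refine le_iSup₂_of_le s ⟨hs, ?_⟩ le_rfl
  refine lt_of_le_of_lt (limsup_le_of_le (by isBoundedDefault) ?_)
    (ENNReal.ofReal_lt_top (r := C))
  filter_upwards [eventually_lt_of_lt_liminf hsL, Ioo_mem_nhdsGT one_pos] with r hr hr01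
  exact hC r hr01.1 hr01.2 hr

/-- Being below a limsup gives the bound only for arbitrarily small r, which is exactly enough for a
finite liminf of the cut-set sums. -/
theorem upperDim_projMeasure_le_dPlus {B q : ℝ} (hTc : ∀ i, ‖T i‖ < 1)
    (hT : ∀ i, (T i).det ≠ 0) (hB : ∀ w, ‖ω w‖ ≤ B) (hq : 1 < q)
    (hN : upperDim q (projMeasure T ω μ) ≤ ((N : ℝ) : EReal)) :
    upperDim q (projMeasure T ω μ) ≤ dPlus T μ q := by
  refine le_coe_of_forall_between hN fun s hs hsN hsL => ?_
  obtain ⟨C, hC⟩ := exists_cutSum_le_of_lt_log_div T ω μ hTc hT hB hq hs hsN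
  refine le_iSup₂_of_le s ⟨hs, ?_⟩ le_rfl
  refine lt_of_le_of_lt (liminf_le_of_frequently_le ?_ (by isBoundedDefault))
    (ENNReal.ofReal_lt_top (r := C))
  have hfreq := frequently_lt_of_lt_limsup (by isBoundedDefault) hsL
  refine (hfreq.and_eventually (Ioo_mem_nhdsGT one_pos)).mono fun r hr => ?_
  exact hC r hr.2.1 hr.2.2 hr.1

end Limits

end AlmostSelfAffine

theorem corollary4p3 {N m : ℕ}
    (T : Fin m → EuclideanSpace ℝ (Fin N) →L[ℝ] EuclideanSpace ℝ (Fin N))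
    (hTcontr : ∀ i, ‖T i‖ < 1) (hTnonsing : ∀ i, (T i).det ≠ 0)
    (μ : Measure (ℕ → Fin m)) [IsFiniteMeasure μ] (hμ : μ ≠ 0)
    (q : ℝ) (hq : 1 < q)
    (D : Set (EuclideanSpace ℝ (Fin N))) (hD : Bornology.IsBounded D)
    (ω : List (Fin m) → EuclideanSpace ℝ (Fin N)) (hω : ∀ w, ω w ∈ D) :
    AlmostSelfAffine.lowerDim q (AlmostSelfAffine.projMeasure T ω μ) ≤
        ((min (AlmostSelfAffine.dMinus T μ q) (N : ℝ≥0∞) : ℝ≥0∞) : EReal) ∧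
      AlmostSelfAffine.upperDim q (AlmostSelfAffine.projMeasure T ω μ) ≤
        ((min (AlmostSelfAffine.dPlus T μ q) (N : ℝ≥0∞) : ℝ≥0∞) : EReal) := by
  obtain ⟨B, hB⟩ := hD.exists_norm_le
  have hωB : ∀ w, ‖ω w‖ ≤ B := fun w => hB _ (hω w)
  have hup := AlmostSelfAffine.upperDim_projMeasure_le T ω μ hTcontr hTnonsing hωB hq hμ
  have hlow := (AlmostSelfAffine.lowerDim_le_upperDim q
    (AlmostSelfAffine.projMeasure T ω μ)).trans hup
  exact ⟨AlmostSelfAffine.le_coe_min_natCast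
      (AlmostSelfAffine.lowerDim_projMeasure_le_dMinus T ω μ hTcontr hTnonsing hωB hq hlow) hlow,
    AlmostSelfAffine.le_coe_min_natCast
      (AlmostSelfAffine.upperDim_projMeasure_le_dPlus T ω μ hTcontr hTnonsing hωB hq hup) hup⟩
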